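/- Let $X$ be a $\mathbb{Q}$-factorial projective variety over $\mathbb{C}$; that is, $X$ is an integral normal projective $\mathbb{C}$-scheme on which every Weil divisor has a positive multiple that is Cartier. For an $\mathbb{R}$-divisor $D$ on $X$, the Iitaka dimension $\kappa(X,D)$ is the maximum of the dimensions of the (closures of the) images of the rational maps given by the nonempty linear systems $|\lfloor mD\rfloor|$, $m\geq 1$, and it is $-\infty$ if all these linear systems are empty. The invariant Iitaka dimension is $\kappa_\iota(X,D):=\kappa(X,D')$ if there is an effective $\mathbb{R}$-divisor $D'$ with $D'\sim_{\mathbb{R}}D$ (the value does not depend on the choice of $D'$), and $\kappa_\iota(X,D):=-\infty$ otherwise. Let $H\geq 0$ be an effective $\mathbb{R}$-divisor on $X$ and let $G$ be an $\mathbb{R}$-divisor on $X$. Suppose that there exists a strictly decreasing sequence of real numbers $(\varepsilon_n)_{n\in\mathbb{N}}$ with $\lim_{n\to\infty}\varepsilon_n=0$ and $\kappa_\iota(X,G+\varepsilon_nH)=0$ for every $n\in\mathbb{N}$. Then $\kappa_\iota(X,G)=0$. -/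

import Mathlib

noncomputable section

namespace IitakaDim

open AlgebraicGeometry CategoryTheory

attribute [local instance] MvPolynomial.gradedAlgebra

/-! ### Complex projective varieties -/

/-- The complex projective space `ℙⁿ = Proj ℂ[x₀, …, xₙ]`. -/
abbrev projSpace (n : ℕ) : Scheme.{0} :=
  Proj (MvPolynomial.homogeneousSubmodule (Fin (n + 1)) ℂ)

/-- The structure morphism `ℙⁿ ⟶ Spec ℂ`, induced by the inclusion of the constants in the ring
of homogeneous polynomials of degree `0`. -/
def projSpaceToSpec (n : ℕ) : projSpace n ⟶ Spec (CommRingCat.of ℂ) :=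
  Proj.toSpecZero (MvPolynomial.homogeneousSubmodule (Fin (n + 1)) ℂ) ≫
    Spec.map (CommRingCat.ofHom
      (algebraMap ℂ (MvPolynomial.homogeneousSubmodule (Fin (n + 1)) ℂ 0)))

/-- `X` is a projective scheme over `ℂ`: it admits a closed immersion over `Spec ℂ` into some
projective space. -/
class IsProjective (X : Scheme.{0}) [X.Over (Spec (CommRingCat.of ℂ))] : Prop where
  exists_closedImmersion : ∃ (n : ℕ) (i : X ⟶ projSpace n),
    IsClosedImmersion i ∧ i ≫ projSpaceToSpec n = X ↘ Spec (CommRingCat.of ℂ)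

/-- All local rings of `X` are integrally closed; for an integral scheme this says that `X` is
normal. -/
class IsNormal (X : Scheme.{0}) : Prop where
  isIntegrallyClosed_stalk : ∀ x : X, IsIntegrallyClosed (X.presheaf.stalk x)

instance locallyOfFiniteType_projSpaceToSpec (n : ℕ) :
    LocallyOfFiniteType (projSpaceToSpec n) := by
  let 𝒜 := MvPolynomial.homogeneousSubmodule (Fin (n + 1)) ℂ
  have hs : Function.Surjective (algebraMap ℂ (𝒜 0)) := by
    rintro ⟨p, hp⟩
    have hp' : p.IsHomogeneous 0 := (MvPolynomial.mem_homogeneousSubmodule 0 p).mp hp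
    refine ⟨p.coeff 0, Subtype.ext ?_⟩
    exact (MvPolynomial.totalDegree_eq_zero_iff_eq_C.mp
      (Nat.le_zero.mp hp'.totalDegree_le)).symm
  have : IsScalarTower ℂ (𝒜 0) (MvPolynomial (Fin (n + 1)) ℂ) :=
    ⟨fun a b c => smul_mul_assoc a (b : MvPolynomial (Fin (n + 1)) ℂ) c⟩
  have : Algebra.FiniteType (𝒜 0) (MvPolynomial (Fin (n + 1)) ℂ) :=
    Algebra.FiniteType.of_restrictScalars_finiteType ℂ (𝒜 0) (MvPolynomial (Fin (n + 1)) ℂ)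
  have : LocallyOfFiniteType (Spec.map (CommRingCat.ofHom (algebraMap ℂ (𝒜 0)))) := by
    rw [HasRingHomProperty.Spec_iff (P := @LocallyOfFiniteType)]
    exact RingHom.FiniteType.of_surjective _ hs
  unfold projSpaceToSpec
  exact inferInstance

instance isLocallyNoetherian_of_isProjective (X : Scheme.{0})
    [X.Over (Spec (CommRingCat.of ℂ))] [IsProjective X] : IsLocallyNoetherian X := by
  obtain ⟨n, i, hi, h⟩ := IsProjective.exists_closedImmersion (X := X)
  have : LocallyOfFiniteType (X ↘ Spec (CommRingCat.of ℂ)) := by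
    rw [← h]; infer_instance
  exact LocallyOfFiniteType.isLocallyNoetherian (X ↘ Spec (CommRingCat.of ℂ))

/-- The function field of an integral scheme over `ℂ` is a `ℂ`-algebra. -/
instance algebraFunctionField (X : Scheme.{0}) [X.Over (Spec (CommRingCat.of ℂ))]
    [IsIntegral X] : Algebra ℂ X.functionField :=
  ((X.presheaf.germ ⊤ (genericPoint X) trivial).hom.comp
    (((X ↘ Spec (CommRingCat.of ℂ)).appTop.hom).comp
      (Scheme.ΓSpecIso (CommRingCat.of ℂ)).inv.hom)).toAlgebra

/-! ### Divisors -/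

/-- The prime divisors of `X`, represented by their generic points: the points of
codimension `1`. -/
abbrev PrimeDivisor (X : Scheme.{0}) : Type := {x : X // Order.coheight x = 1}

/-- Weil divisors. -/
abbrev WeilDivisor (X : Scheme.{0}) : Type := PrimeDivisor X →₀ ℤ

/-- `ℝ`-divisors: finite formal `ℝ`-linear combinations of prime divisors. The order `≤` is
coefficientwise, so that `0 ≤ D` says that `D` is effective. -/
abbrev RDivisor (X : Scheme.{0}) : Type := PrimeDivisor X →₀ ℝ

section

variable {X : Scheme.{0}} [IsIntegral X] [IsLocallyNoetherian X]

/-- A Weil divisor is Cartier if it is locally the divisor of a nonzero rational function. -/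
def IsCartier (D : WeilDivisor X) : Prop :=
  ∀ x : X, ∃ (U : X.Opens) (f : X.functionField), x ∈ U ∧ f ≠ 0 ∧
    ∀ P : PrimeDivisor X, P.1 ∈ U → D P = Scheme.ord f P.1

/-- `D₁ ∼_ℝ D₂`: the difference `D₂ - D₁` is a finite `ℝ`-linear combination of divisors
`(f) = ∑ ord_P(f) P` of nonzero rational functions `f`. -/
def RLinEquiv (D₁ D₂ : RDivisor X) : Prop :=
  ∃ (k : ℕ) (r : Fin k → ℝ) (f : Fin k → X.functionField), (∀ i, f i ≠ 0) ∧
    ∀ P : PrimeDivisor X, D₂ P = D₁ P + ∑ i, r i * (Scheme.ord (f i) P.1 : ℝ)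

/-- The global sections `H⁰(X, 𝒪_X(⌊mD⌋))`: the rational functions `f` such that `f = 0` or
`(f) + ⌊mD⌋ ≥ 0`, where the round-down is taken coefficientwise. -/
def sections (D : RDivisor X) (m : ℕ) : Set X.functionField :=
  {f | f = 0 ∨ ∀ P : PrimeDivisor X, 0 ≤ Scheme.ord f P.1 + ⌊(m : ℝ) * D P⌋}

end

/-- `ℚ`-factorial: normal, and every Weil divisor has a positive multiple which is Cartier. -/
class IsQFactorial (X : Scheme.{0}) [IsIntegral X] [IsLocallyNoetherian X] : Prop
    extends IsNormal X where
  exists_isCartier : ∀ D : WeilDivisor X, ∃ m : ℕ, 0 < m ∧ IsCartier (m • D)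

/-! ### Iitaka dimensions -/

section

variable {X : Scheme.{0}} [X.Over (Spec (CommRingCat.of ℂ))] [IsIntegral X]
  [IsLocallyNoetherian X]

/-- The dimension of the closure of the image of the rational map `X ⇢ ℙᴺ` given by the linear
system `|⌊mD⌋|`, that is, the transcendence degree over `ℂ` of its function field, which is the
subfield of the function field of `X` generated by the quotients of sections. -/
def imageDim (D : RDivisor X) (m : ℕ) : ℕ∞ :=
  Cardinal.toENat (Algebra.trdeg ℂ (IntermediateField.adjoin ℂ
    {h : X.functionField | ∃ f ∈ sections D m, ∃ g ∈ sections D m, g ≠ 0 ∧ h = f / g}))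

open Classical in
/-- The Iitaka dimension `κ(X, D)`: the maximum of the dimensions of the images of the maps given
by the nonempty linear systems `|⌊mD⌋|`, `m ≥ 1`; it is `-∞` (here `⊥`) if all these linear
systems are empty. -/
def kappa (D : RDivisor X) : WithBot ℕ∞ :=
  ⨆ m : ℕ, if 0 < m ∧ ∃ f ∈ sections D m, f ≠ 0 then (imageDim D m : WithBot ℕ∞) else ⊥

open Classical in
/-- The invariant Iitaka dimension `κ_ι(X, D)`: it is `κ(X, D')` for an effective `ℝ`-divisor
`D' ∼_ℝ D` (it does not depend on the choice of `D'`), and `-∞` (here `⊥`) if there is no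
such `D'`. -/
def kappaIota (D : RDivisor X) : WithBot ℕ∞ :=
  if h : ∃ D' : RDivisor X, 0 ≤ D' ∧ RLinEquiv D D' then kappa h.choose else ⊥

end

end IitakaDim

end

namespace IitakaDim

open AlgebraicGeometry CategoryTheory

/-! An effective `D` with `kappa D = 0` is alone in its `ℝ`-linear class (`eq_of_kappa_eq_zero`).
Otherwise some `E - D = ∑ r i • (f i)` is nonzero; a `ℚ`-linear map `ℝ → ℚ` preserving the signs of
its coefficients, followed by clearing denominators, gives a function `g` whose divisor has those
same signs. Its poles lie in the support of `D`, so `g` is a nonconstant section of a multiple of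
`D`. Now take effective `D n ∼ G + ε n • H`. Uniqueness forces `D n + (ε 0 - ε n) • H = D 0`, so `D
0 - ε 0 • H` is the limit of the `D n`: it is effective and equivalent to `G`. Any effective `E ∼ G`
satisfies `E + ε 0 • H = D 0`, whence `kappa E ≤ kappa (D 0) = 0`. -/

/-- Finitely many positive reals can be kept positive by a suitable `ℚ`-linear map `ℝ → ℚ`. -/
theorem exists_ratLinearMap_pos (A : Finset ℝ) :
    ∃ φ : ℝ →ₗ[ℚ] ℚ, ∀ a ∈ A, 0 < a → 0 < φ a := by
  let b := Module.Basis.ofVectorSpace ℚ ℝ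
  -- `L · q` is the `ℚ`-linear map sending the basis `b` to `q`. It is the identity at `q = b`, and
  -- positivity is open in `q`, so a rational `q` near `b` works.
  let L : ℝ → (_ → ℝ) → ℝ := fun a q => (b.repr a).sum fun i c => (c : ℝ) * q i
  have hL : ∀ a, Continuous (L a) := fun a => by
    simp only [L, Finsupp.sum]
    fun_prop
  have hLb : ∀ a, L a (fun i => b i) = a := fun a => by
    conv_rhs => rw [← b.linearCombination_repr a, Finsupp.linearCombination_apply]
    simp only [L, Rat.smul_def]
  have hU : IsOpen (⋂ a ∈ A.filter (0 < ·), {q | 0 < L a q}) :=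
    isOpen_biInter_finset fun a _ => isOpen_lt continuous_const (hL a)
  have hdense : DenseRange (Pi.map fun (_ : Module.Basis.ofVectorSpaceIndex ℚ ℝ) (q : ℚ) => (q : ℝ)) :=
    DenseRange.piMap fun _ => Rat.denseRange_cast
  obtain ⟨q, hq⟩ := hdense.exists_mem_open hU ⟨fun i => b i, by
    simp only [Set.mem_iInter, Finset.mem_filter, Set.mem_ofPred_eq, hLb]
    exact fun a ha => ha.2⟩
  refine ⟨b.constr ℚ q, fun a ha hpos => ?_⟩
  simp only [Set.mem_iInter, Finset.mem_filter, Set.mem_ofPred_eq] at hq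
  have h := hq a ⟨ha, hpos⟩
  have hcast : ((b.constr ℚ q a : ℚ) : ℝ) = L a (Pi.map (fun _ (q : ℚ) => (q : ℝ)) q) := by
    simp [L, Module.Basis.constr_apply, Finsupp.sum, Pi.map]
  rw [← hcast] at h
  exact_mod_cast h

/-! ### Orders of rational functions and sections of divisors -/

section

variable {X : Scheme.{0}} [IsIntegral X] [IsLocallyNoetherian X]

theorem RLinEquiv.symm {D₁ D₂ : RDivisor X} (h : RLinEquiv D₁ D₂) : RLinEquiv D₂ D₁ := by
  obtain ⟨k, r, f, hf, h⟩ := h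
  refine ⟨k, fun i => -r i, f, hf, fun P => ?_⟩
  simp [h P]

theorem RLinEquiv.trans {D₁ D₂ D₃ : RDivisor X} (h₁ : RLinEquiv D₁ D₂) (h₂ : RLinEquiv D₂ D₃) :
    RLinEquiv D₁ D₃ := by
  obtain ⟨k, r, f, hf, h⟩ := h₁
  obtain ⟨l, s, g, hg, h'⟩ := h₂
  refine ⟨k + l, Fin.append r s, Fin.append f g, fun i => ?_, fun P => ?_⟩
  · induction i using Fin.addCases <;> simp [hf, hg]
  · simp [h' P, h P, Fin.sum_univ_add, add_assoc]

theorem RLinEquiv.add_right {D₁ D₂ : RDivisor X} (h : RLinEquiv D₁ D₂) (E : RDivisor X) :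
    RLinEquiv (D₁ + E) (D₂ + E) := by
  obtain ⟨k, r, f, hf, h⟩ := h
  refine ⟨k, r, f, hf, fun P => ?_⟩
  simp only [Finsupp.add_apply, h P]
  ring

theorem ord_one (x : X) : Scheme.ord (1 : X.functionField) x = 0 := by
  have h := Scheme.ord_mul (x := x) (one_ne_zero (α := X.functionField)) one_ne_zero
  rw [mul_one] at h
  omega

theorem ord_inv {f : X.functionField} (hf : f ≠ 0) (x : X) :
    Scheme.ord f⁻¹ x = -Scheme.ord f x := by
  have h := Scheme.ord_mul (x := x) hf (inv_ne_zero hf)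
  rw [mul_inv_cancel₀ hf, ord_one] at h
  omega

theorem ord_zpow {f : X.functionField} (hf : f ≠ 0) (n : ℤ) (x : X) :
    Scheme.ord (f ^ n) x = n * Scheme.ord f x := by
  induction n with
  | zero => simp [ord_one]
  | succ n ih => rw [zpow_add_one₀ hf, Scheme.ord_mul (zpow_ne_zero _ hf) hf, ih]; ring
  | pred n ih =>
    rw [zpow_sub_one₀ hf, Scheme.ord_mul (zpow_ne_zero _ hf) (inv_ne_zero hf), ih, ord_inv hf]
    ring

theorem ord_prod {ι : Type*} (s : Finset ι) {f : ι → X.functionField} (hf : ∀ i, f i ≠ 0) (x : X) :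
    Scheme.ord (∏ i ∈ s, f i) x = ∑ i ∈ s, Scheme.ord (f i) x := by
  classical
  induction s using Finset.induction_on with
  | empty => simp [ord_one]
  | insert a s ha ih =>
    rw [Finset.prod_insert ha, Finset.sum_insert ha,
      Scheme.ord_mul (hf a) (Finset.prod_ne_zero_iff.mpr fun i _ => hf i), ih]

theorem one_mem_sections {D : RDivisor X} (hD : 0 ≤ D) (m : ℕ) : 1 ∈ sections D m :=
  Or.inr fun P => by
    rw [ord_one, zero_add]
    exact Int.floor_nonneg.mpr (mul_nonneg m.cast_nonneg (hD P))

theorem sections_mono {D E : RDivisor X} (h : D ≤ E) (m : ℕ) : sections D m ⊆ sections E m := by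
  rintro f (hf | hf)
  · exact Or.inl hf
  · exact Or.inr fun P => (hf P).trans <| add_le_add_right
      (Int.floor_mono (mul_le_mul_of_nonneg_left (h P) m.cast_nonneg)) _

theorem mem_sections_of_nonneg {D : RDivisor X} {m : ℕ} {f : X.functionField}
    (h : ∀ P : PrimeDivisor X, 0 ≤ (Scheme.ord f P.1 : ℝ) + m * D P) : f ∈ sections D m :=
  Or.inr fun P => by
    rw [← Int.floor_intCast_add]
    exact Int.floor_nonneg.mpr (h P)

/-- If an effective divisor `D` is `ℝ`-linearly equivalent to another effective divisor, then some
multiple `mD` has a section which is not constant. -/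
theorem exists_section_ord_ne_zero {D E : RDivisor X} (hD : 0 ≤ D) (hE : 0 ≤ E)
    (h : RLinEquiv D E) (hne : E ≠ D) :
    ∃ m : ℕ, 0 < m ∧ ∃ f ∈ sections D m, f ≠ 0 ∧
      ∃ P : PrimeDivisor X, Scheme.ord f P.1 ≠ 0 := by
  classical
  obtain ⟨k, r, f, hf, h⟩ := h
  let F : RDivisor X := E - D
  have hF : ∀ P, F P = ∑ i, r i * (Scheme.ord (f i) P.1 : ℝ) := fun P => by simp [F, h P]
  obtain ⟨φ, hφ⟩ := exists_ratLinearMap_pos (F.support.image F ∪ F.support.image (-F))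
  have hpos : ∀ P, 0 < F P → 0 < φ (F P) := fun P hP => by
    refine hφ _ (Finset.mem_union_left _ (Finset.mem_image_of_mem _ ?_)) hP
    exact Finsupp.mem_support_iff.mpr hP.ne'
  have hneg : ∀ P, F P < 0 → φ (F P) < 0 := fun P hP => by
    have := hφ (-F P) (Finset.mem_union_right _ (Finset.mem_image.mpr
      ⟨P, Finsupp.mem_support_iff.mpr hP.ne, rfl⟩)) (neg_pos.mpr hP)
    rw [map_neg] at this
    linarith
  obtain ⟨⟨N, hN⟩, hint⟩ := IsLocalization.exist_integer_multiples_of_finite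
    (nonZeroDivisors ℤ) (fun i => φ (r i))
  have hN0 : N ≠ 0 := nonZeroDivisors.ne_zero hN
  choose n hn using hint
  have hn' : ∀ i, (n i : ℚ) = N * φ (r i) := fun i => by simpa using hn i
  -- The extra factor `N` makes the scale `N ^ 2`, positive whatever the sign of `N`.
  let g : X.functionField := ∏ i, f i ^ (N * n i)
  have hg0 : g ≠ 0 := Finset.prod_ne_zero_iff.mpr fun i _ => zpow_ne_zero _ (hf i)
  have hg : ∀ P : PrimeDivisor X, (Scheme.ord g P.1 : ℚ) = (N : ℚ) ^ 2 * φ (F P) := fun P => by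
    rw [ord_prod _ (fun i => zpow_ne_zero _ (hf i)), hF, map_sum, Finset.mul_sum, Int.cast_sum]
    refine Finset.sum_congr rfl fun i _ => ?_
    have : r i * (Scheme.ord (f i) P.1 : ℝ) = (Scheme.ord (f i) P.1) • r i := by
      rw [zsmul_eq_mul, mul_comm]
    rw [ord_zpow (hf i), this, map_zsmul, zsmul_eq_mul]
    push_cast
    rw [hn']
    ring
  have hN2 : (0 : ℚ) < (N : ℚ) ^ 2 := by positivity
  obtain ⟨M, hM⟩ : ∃ M : ℕ, ∀ P ∈ D.support, -(Scheme.ord g P.1 : ℝ) / D P ≤ M := by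
    obtain ⟨M, hM⟩ := exists_nat_ge (∑ P ∈ D.support, |-(Scheme.ord g P.1 : ℝ) / D P|)
    exact ⟨M, fun P hP => (le_abs_self _).trans <| (Finset.single_le_sum
      (f := fun P => |-(Scheme.ord g P.1 : ℝ) / D P|) (fun _ _ => abs_nonneg _) hP).trans hM⟩
  refine ⟨M + 1, M.succ_pos, g, mem_sections_of_nonneg fun P => ?_, hg0, ?_⟩
  · have hDP : 0 ≤ D P := hD P
    by_cases hP : D P = 0
    · have hFP : 0 ≤ F P := by simpa [F, hP] using hE P
      have : (0 : ℚ) ≤ φ (F P) := by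
        rcases hFP.eq_or_lt with h0 | h0
        · rw [← h0, map_zero]
        · exact (hpos P h0).le
      have : (0 : ℚ) ≤ (Scheme.ord g P.1 : ℚ) := hg P ▸ mul_nonneg hN2.le this
      rw [hP, mul_zero, add_zero]
      exact_mod_cast this
    · have h1 := hM P (Finsupp.mem_support_iff.mpr hP)
      rw [div_le_iff₀ (lt_of_le_of_ne hDP (Ne.symm hP))] at h1
      push_cast
      linarith
  · obtain ⟨P, hP⟩ := DFunLike.ne_iff.mp (sub_ne_zero.mpr hne : F ≠ 0)
    refine ⟨P, fun h0 => ?_⟩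
    have h1 := hg P
    rw [h0, Int.cast_zero, eq_comm, mul_eq_zero, or_iff_right hN2.ne'] at h1
    rcases lt_or_gt_of_ne hP with h2 | h2
    · exact (hneg P h2).ne h1
    · exact (hpos P h2).ne' h1

end

/-! ### Iitaka dimension -/

section

variable {X : Scheme.{0}} [X.Over (Spec (CommRingCat.of ℂ))] [IsIntegral X]
  [IsLocallyNoetherian X]

theorem ord_algebraMap (c : ℂ) (x : X) : Scheme.ord (algebraMap ℂ X.functionField c) x = 0 := by
  rcases eq_or_ne c 0 with rfl | hc
  · simp
  have hu : IsUnit ((((X ↘ Spec (CommRingCat.of ℂ)).appTop.hom).comp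
      (Scheme.ΓSpecIso (CommRingCat.of ℂ)).inv.hom) c) := (IsUnit.mk0 c hc).map _
  have : Nonempty (⊤ : X.Opens) := ⟨⟨x, trivial⟩⟩
  exact Scheme.ord_of_isUnit (U := ⊤) hu (x := x) trivial

/-- Since `ℂ` is algebraically closed, algebraic elements are constants, which have order `0`
everywhere. -/
theorem transcendental_of_ord_ne_zero {f : X.functionField} {x : X} (h : Scheme.ord f x ≠ 0) :
    Transcendental ℂ f := fun hf => by
  obtain ⟨c, rfl⟩ : f ∈ (algebraMap ℂ X.functionField).range :=
    minpoly.mem_range_of_degree_eq_one ℂ f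
      (IsAlgClosed.degree_eq_one_of_irreducible ℂ (minpoly.irreducible hf.isIntegral))
  exact h (ord_algebraMap c x)

theorem imageDim_mono {D E : RDivisor X} (h : D ≤ E) (m : ℕ) : imageDim D m ≤ imageDim E m := by
  refine Cardinal.toENat.monotone' (trdeg_le_of_injective
    (IntermediateField.inclusion (IntermediateField.adjoin.mono _ _ _ ?_))
    (IntermediateField.inclusion_injective _))
  rintro _ ⟨f, hf, g, hg, hg0, rfl⟩
  exact ⟨f, sections_mono h m hf, g, sections_mono h m hg, hg0, rfl⟩

theorem kappa_mono {D E : RDivisor X} (h : D ≤ E) : kappa D ≤ kappa E := by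
  classical
  refine iSup_mono fun m => ?_
  split_ifs with h₁ h₂
  · exact WithBot.coe_le_coe.mpr (imageDim_mono h m)
  · exact absurd ⟨h₁.1, h₁.2.imp fun _ hf => ⟨sections_mono h m hf.1, hf.2⟩⟩ h₂
  all_goals exact bot_le

theorem imageDim_le_kappa {D : RDivisor X} {m : ℕ} (hm : 0 < m)
    (h : ∃ f ∈ sections D m, f ≠ 0) : (imageDim D m : WithBot ℕ∞) ≤ kappa D := by
  refine le_iSup_of_le m ?_
  rw [if_pos ⟨hm, h⟩]

theorem kappa_nonneg {D : RDivisor X} (hD : 0 ≤ D) : 0 ≤ kappa D :=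
  (WithBot.coe_le_coe.mpr (zero_le (a := imageDim D 1))).trans
    (imageDim_le_kappa one_pos ⟨1, one_mem_sections hD 1, one_ne_zero⟩)

theorem imageDim_pos {D : RDivisor X} (hD : 0 ≤ D) {m : ℕ} {f : X.functionField}
    (hf : f ∈ sections D m) (h : Transcendental ℂ f) : 0 < imageDim D m := by
  let S := {h : X.functionField | ∃ f ∈ sections D m, ∃ g ∈ sections D m, g ≠ 0 ∧ h = f / g}
  have hS : f ∈ IntermediateField.adjoin ℂ S := IntermediateField.subset_adjoin _ _
    ⟨f, hf, 1, one_mem_sections hD m, one_ne_zero, (div_one f).symm⟩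
  have : Algebra.Transcendental ℂ (IntermediateField.adjoin ℂ S) :=
    ⟨⟨⟨f, hS⟩, fun h' => h (h'.algebraMap (A := X.functionField))⟩⟩
  have h1 := trdeg_pos ℂ (IntermediateField.adjoin ℂ S)
  rw [pos_iff_ne_zero] at h1 ⊢
  simpa [imageDim] using h1

/-- An effective divisor of Iitaka dimension `0` is the only effective divisor in its `ℝ`-linear
equivalence class. -/
theorem eq_of_kappa_eq_zero {D E : RDivisor X} (hD : 0 ≤ D) (hE : 0 ≤ E) (h : RLinEquiv D E)
    (hκ : kappa D = 0) : E = D := by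
  by_contra hne
  obtain ⟨m, hm, f, hf, hf0, P, hP⟩ := exists_section_ord_ne_zero hD hE h hne
  have h1 := imageDim_le_kappa hm ⟨f, hf, hf0⟩
  have h2 := imageDim_pos hD hf (transcendental_of_ord_ne_zero hP)
  rw [hκ] at h1
  exact h2.not_ge (WithBot.coe_le_coe.mp h1)

theorem exists_effective_of_kappaIota_eq_zero {D : RDivisor X} (h : kappaIota D = 0) :
    ∃ D' : RDivisor X, 0 ≤ D' ∧ RLinEquiv D D' ∧ kappa D' = 0 := by
  unfold kappaIota at h
  split_ifs at h with hex
  · exact ⟨hex.choose, hex.choose_spec.1, hex.choose_spec.2, h⟩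
  · exact absurd h WithBot.bot_ne_coe

/-- Quantifying over all representatives covers the arbitrarily chosen one, so independence of the
choice is not needed. -/
theorem kappaIota_eq_zero_of_forall {D : RDivisor X}
    (hex : ∃ D' : RDivisor X, 0 ≤ D' ∧ RLinEquiv D D')
    (h : ∀ D' : RDivisor X, 0 ≤ D' → RLinEquiv D D' → kappa D' = 0) : kappaIota D = 0 := by
  rw [kappaIota, dif_pos hex]
  exact h _ hex.choose_spec.1 hex.choose_spec.2

end

end IitakaDim

theorem lemma3p1 (X : AlgebraicGeometry.Scheme.{0})
    [X.Over (AlgebraicGeometry.Spec (CommRingCat.of ℂ))] [AlgebraicGeometry.IsIntegral X]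
    [IitakaDim.IsProjective X] [IitakaDim.IsQFactorial X]
    (H G : IitakaDim.RDivisor X) (hH : 0 ≤ H)
    (ε : ℕ → ℝ) (hε : StrictAnti ε)
    (hlim : Filter.Tendsto ε Filter.atTop (nhds 0))
    (hκ : ∀ n, IitakaDim.kappaIota (G + ε n • H) = 0) :
    IitakaDim.kappaIota G = 0 := by
  choose D hD hGD hκD using fun n => IitakaDim.exists_effective_of_kappaIota_eq_zero (hκ n)
  have hunique : ∀ E : IitakaDim.RDivisor X, 0 ≤ E →
      IitakaDim.RLinEquiv (G + ε 0 • H) E → E = D 0 := fun E hE h =>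
    IitakaDim.eq_of_kappa_eq_zero (hD 0) hE ((hGD 0).symm.trans h) (hκD 0)
  have hDn : ∀ n, D n + (ε 0 - ε n) • H = D 0 := fun n => by
    refine hunique _ (add_nonneg (hD n)
      (smul_nonneg (sub_nonneg.mpr (hε.antitone n.zero_le)) hH)) ?_
    convert (hGD n).add_right ((ε 0 - ε n) • H) using 1
    module
  refine IitakaDim.kappaIota_eq_zero_of_forall ⟨D 0 - ε 0 • H, fun P => ?_, ?_⟩
    fun E hE hGE => le_antisymm ?_ (IitakaDim.kappa_nonneg hE)
  · have hlim' : Filter.Tendsto (fun n => D 0 P - (ε 0 - ε n) * H P) Filter.atTop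
        (nhds (D 0 P - (ε 0 - 0) * H P)) :=
      tendsto_const_nhds.sub ((tendsto_const_nhds.sub hlim).mul_const _)
    rw [sub_zero] at hlim'
    refine ge_of_tendsto' hlim' fun n => ?_
    have h1 := DFunLike.congr_fun (hDn n) P
    have h2 : 0 ≤ D n P := hD n P
    simp only [Finsupp.add_apply, Finsupp.smul_apply, smul_eq_mul] at h1
    simp only [Finsupp.coe_zero, Pi.zero_apply]
    linarith
  · convert (hGD 0).add_right (-(ε 0 • H)) using 1 <;> module
  · have hε0 : 0 ≤ ε 0 • H :=
      smul_nonneg (hε.antitone.le_of_tendsto hlim 0) hH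
    rw [← hκD 0, ← hunique _ (add_nonneg hE hε0) (hGE.add_right _)]
    exact IitakaDim.kappa_mono (le_add_of_nonneg_right hε0)
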